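/- Let $M=(S,A,P,r)$ be a finite deterministic Markov decision process: $S$, $A$ are finite, there is $g:S\times A\to S$ with $P(s'\mid s,a)=1$ if $s'=g(s,a)$ and $0$ otherwise, the rewards $r(s,a,s')$ are real, $r(s,a)=r(s,a,g(s,a))$, and some of the states are terminal (episodes end there, no further reward is received). Let $\gamma\in[0,1)$ be the discount factor and $\beta\in[0,1]$ the diffusion coefficient. Let $Q^*(s,a)=\sup_\pi \mathbb E_\pi\big[\sum_{n\ge 0}\gamma^n r_n \,\big|\, s_0=s,a_0=a\big]$ be the optimal Q-function. For a pair $(s,a)$ let the path set $p_{s,a}$ be the set of all finite episodes $p=(s_0,a_0,s_1,a_1,\dots,s_l)$ with $(s_0,a_0)=(s,a)$, $P(s_{k+1}\mid s_k,a_k)>0$ for $0\le k<l$, $l\ge 1$, $s_l$ terminal and $s_k$ not terminal for $1\le k<l$; write $|p|=l$. For $Q:S\times A\to\mathbb R$ and $1\le j\le |p|$ put $$T_p^{\beta,Q}(j)=\sum_{k=1}^{j-1}\beta^{k-1}\gamma^{k-1}\big\{\beta\, r(s_k,a_k)+(1-\beta)Q(s_k,a_k)\big\}+\beta^{j-1}\gamma^{j-1}\max_{a'\ne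 a_j}Q(s_j,a'),$$ where the last maximum is read as $0$ for $j=|p|$ (the state $s_{|p|}$ is terminal), and where, if $|A|=1$, only $j=|p|$ is admitted. Consider a random process with values $(s_t,a_t)\in S\times A$ (the visited pairs), $\alpha_t\in\mathbb R$ (the step sizes) and schedules $\lambda_{s,a}(t)$, where for all $t\ge 0$ and all $(s,a)$ with $s$ not terminal $\lambda_{s,a}(t)$ is almost surely a probability distribution on $p_{s,a}$ (e.g. the empirical frequencies of the episodes sampled from $(s,a)$, or the point mass at one sampled episode). Starting from an arbitrary (random) $Q_0$, the tabular episodic backward update is $$Q_{t+1}(s_t,a_t)=(1-\alpha_t)Q_t(s_t,a_t)+\alpha_t\Big[r(s_t,a_t)+\gamma\sum_{p\in p_{s_t,a_t}}\lambda_{s_t,a_t}(t)(p)\max_{1\le j\le |p|}T_p^{\beta,Q_t}(j)\Big],$$ and $Q_{t+1}(s,a)=Q_t(s,a)$ for $(s,a)\ne(s_t,a_t)$. Assume: 1. (Robbins–Monro) with $\alpha_t(s,a)=\alpha_t$ if $(s,a)=(s_t,a_t)$ and $\alpha_t(s,a)=0$ otherwise, almost surely $0\le\alpha_t\le 1$ for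 all $t$, and $\sum_t\alpha_t(s,a)=\infty$, $\sum_t\alpha_t(s,a)^2<\infty$ for every $(s,a)$ with $s$ not terminal; 2. for every $t$ the length $l_t$ of a trajectory drawn from $\lambda_{s_t,a_t}(t)$ has finite expectation, $\mathbb E[l_t]=\mathbb E\big[\sum_p\lambda_{s_t,a_t}(t)(p)\,|p|\big]<\infty$; 3. almost surely every pair $(s,a)$ with $s$ not terminal is visited infinitely often, i.e. $(s_t,a_t)=(s,a)$ for infinitely many $t$. Then with probability $1$, $Q_t(s,a)\to Q^*(s,a)$ for every $(s,a)$ with $s$ not terminal. -/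

import Mathlib

open MeasureTheory Filter Topology

/-- A finite (tabular) Markov decision process: transition probabilities `P s a s' = P(s' | s, a)`,
rewards `r s a s'`, and a set of terminal states, at which an episode ends. -/
structure MDP (S A : Type*) where
  P : S → A → PMF S
  r : S → A → S → ℝ
  terminal : Set S

namespace MDP

variable {S A : Type*}

/-- The transitions are given by a function `g : S × A → S`:
`P(s' | s, a) = 1` if `s' = g (s, a)` and `0` otherwise. -/
def IsDeterministic (M : MDP S A) : Prop :=
  ∃ g : S → A → S, ∀ s a, M.P s a = PMF.pure (g s a)

/-- The mean reward `r(s, a) = ∑ s', P(s' | s, a) r(s, a, s')`. For a deterministic MDP this is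
`r(s, a, g (s, a))`. -/
noncomputable def reward [Fintype S] (M : MDP S A) (s : S) (a : A) : ℝ :=
  ∑ s', (M.P s a s').toReal * M.r s a s'

open Classical in
/-- The expectation of the reward received `n` steps after taking action `a` in state `s`, when all
later actions are drawn from the policy `π`. No reward is received after a terminal state. -/
noncomputable def expReward [Fintype S] [Fintype A] (M : MDP S A) (π : S → PMF A) :
    ℕ → S → A → ℝ
  | 0, s, a => M.reward s a
  | n + 1, s, a => ∑ s', (M.P s a s').toReal *
      if s' ∈ M.terminal then 0 else ∑ a', (π s' a').toReal * M.expReward π n s' a'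

/-- The action-value function of the policy `π`: the expected discounted return. -/
noncomputable def actionValue [Fintype S] [Fintype A] (M : MDP S A) (γ : ℝ) (π : S → PMF A)
    (s : S) (a : A) : ℝ :=
  ∑' n, γ ^ n * M.expReward π n s a

/-- The optimal Q-function: the best expected discounted return over all policies. -/
noncomputable def optimalQ [Fintype S] [Fintype A] (M : MDP S A) (γ : ℝ) (s : S) (a : A) : ℝ :=
  ⨆ π : S → PMF A, M.actionValue γ π s a

/-- The path set of `(s, a)`: the finite episodes which start with the pair `(s, a)`, follow
transitions of positive probability, and end at the first terminal state they reach. -/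
inductive Path (M : MDP S A) : S → A → Type _
  /-- The action `a` leads from `s` to the terminal state `s'`. -/
  | last (s : S) (a : A) (s' : S) (hP : 0 < M.P s a s') (hs' : s' ∈ M.terminal) : Path M s a
  /-- The action `a` leads from `s` to the non-terminal state `s'`, where the episode continues
  with the action `a'`. -/
  | cons (s : S) (a : A) (s' : S) (a' : A) (hP : 0 < M.P s a s') (hs' : s' ∉ M.terminal)
      (p : Path M s' a') : Path M s a

namespace Path

variable {M : MDP S A}

/-- The length of an episode: its number of transitions. -/
def length : {s : S} → {a : A} → M.Path s a → ℕ
  | _, _, last .. => 1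
  | _, _, cons _ _ _ _ _ _ p => p.length + 1

/-- The `k`-th state of the episode, for `0 ≤ k ≤ p.length`; the state number `p.length` is the
terminal one. -/
def st : {s : S} → {a : A} → M.Path s a → ℕ → S
  | _, _, last s _ _ _ _, 0 => s
  | _, _, last _ _ s' _ _, _ + 1 => s'
  | _, _, cons s _ _ _ _ _ _, 0 => s
  | _, _, cons _ _ _ _ _ _ p, k + 1 => p.st k

/-- The `k`-th action of the episode, for `0 ≤ k < p.length`. -/
def act : {s : S} → {a : A} → M.Path s a → ℕ → A
  | _, _, last _ a _ _ _, _ => a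
  | _, _, cons _ a _ _ _ _ _, 0 => a
  | _, _, cons _ _ _ _ _ _ p, k + 1 => p.act k

open Classical in
/-- The return `T(j)`, `1 ≤ j ≤ p.length`, of the episode `p` followed up to its `j`-th state:
`∑_{k=1}^{j-1} β^{k-1} γ^{k-1} {β r(s_k, a_k, s_{k+1}) + (1 - β) Q(s_k, a_k)}`
`+ β^{j-1} γ^{j-1} max_{a ≠ a_j} Q(s_j, a)`.
The last maximum is `0` for `j = p.length`, as `s_j` is then terminal and has value zero. -/
noncomputable def T {s : S} {a : A} (β γ : ℝ) (Q : S → A → ℝ) (p : M.Path s a) (j : ℕ) : ℝ :=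
  (∑ k ∈ Finset.Ico 1 j, β ^ (k - 1) * γ ^ (k - 1) *
      (β * M.r (p.st k) (p.act k) (p.st (k + 1)) + (1 - β) * Q (p.st k) (p.act k))) +
    β ^ (j - 1) * γ ^ (j - 1) *
      (if j = p.length then 0 else ⨆ b : {b : A // b ≠ p.act j}, Q (p.st j) b)

/-- The backward return `max_{1 ≤ j ≤ p.length} T(j)` of the episode `p`. Indices `j < p.length`
for which there is no action other than `a_j`, so that `max_{a ≠ a_j}` is over the empty set, do not
count; there are none if there are at least two actions. -/
noncomputable def maxT {s : S} {a : A} (β γ : ℝ) (Q : S → A → ℝ) (p : M.Path s a) : ℝ :=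
  sSup (p.T β γ Q '' {j | 1 ≤ j ∧ j ≤ p.length ∧ (j = p.length ∨ ∃ b : A, b ≠ p.act j)})

end Path

/-- A schedule for `(s, a)`: a probability distribution on the path set. -/
def IsSchedule {M : MDP S A} {s : S} {a : A} (w : M.Path s a → ℝ) : Prop :=
  (∀ p, 0 ≤ w p) ∧ HasSum w 1

open Classical in
/-- The tabular episodic backward update. At time `t` only the entry of the pair
`x t = (s_t, a_t)` is changed, with step size `α t` and with the target
`r(s_t, a_t) + γ ∑_p w_p max_j T_p(j)`, where `w = sched t s_t a_t` is the schedule in force. -/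
noncomputable def ebu [Fintype S] (M : MDP S A) (β γ : ℝ) (Q₀ : S → A → ℝ)
    (x : ℕ → S × A) (α : ℕ → ℝ) (sched : ℕ → (s : S) → (a : A) → M.Path s a → ℝ) :
    ℕ → S → A → ℝ
  | 0 => Q₀
  | t + 1 => fun s a =>
      if (s, a) = x t then
        (1 - α t) * M.ebu β γ Q₀ x α sched t s a + α t * (M.reward s a +
          γ * ∑' p : M.Path s a, sched t s a p * p.maxT β γ (M.ebu β γ Q₀ x α sched t))
      else M.ebu β γ Q₀ x α sched t s a

open Classical in
/-- The step size `α_t(s, a)` with which the pair `(s, a)` is updated at time `t`: it is `α t` if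
the pair is the visited one and `0` otherwise. -/
noncomputable def stepAt (x : ℕ → S × A) (α : ℕ → ℝ) (s : S) (a : A) (t : ℕ) : ℝ :=
  if (s, a) = x t then α t else 0

/-- The Robbins-Monro condition on the step sizes: `0 ≤ α_t ≤ 1`, and for all pairs `(s, a)` with
`s` not terminal, `∑_t α_t(s, a) = ∞` and `∑_t α_t(s, a)² < ∞`. -/
def RobbinsMonro (M : MDP S A) (x : ℕ → S × A) (α : ℕ → ℝ) : Prop :=
  (∀ t, 0 ≤ α t ∧ α t ≤ 1) ∧
    ∀ s ∉ M.terminal, ∀ a, Tendsto (fun n => ∑ t ∈ Finset.range n, stepAt x α s a t) atTop atTop ∧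
      Summable (fun t => stepAt x α s a t ^ 2)

end MDP

/-! The argument is deterministic and runs for each sample point separately. Write V for the state
value of Q*. For every single episode p from (s,a), the map sending Q to `maxT` is nonexpansive in
the sup norm over non-terminal pairs (`Path.abs_maxT_sub_le`), and at Q* it equals V(g(s,a)) exactly
(`Path.maxT_eq_stateValue`). Both facts survive averaging over any schedule. So, whatever the
schedules are, the target is a γ-contraction towards Q*, and there is no noise to average out. The
errors then satisfy an asynchronous contraction inequality, and divergence of the step sums drives
them to 0.

Exactness at Q* comes from the Bellman equation: β r + (1-β)Q* = Q* - βγ V(next state). If all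
actions before index j are greedy, the sum in T(j) telescopes to V(s_1) - (βγ)^(j-1) V(s_j);
non-greedy actions only lower it. Hence T(j) ≤ V(s_1), with equality at the first j where an action
other than a_j is optimal, or at the end of the episode. -/

/-! ### Asynchronous contractions -/

/-- Asynchronous contraction with diverging step sizes. -/
theorem tendsto_zero_of_async_contraction {ι : Type*} [Finite ι] {γ : ℝ} (hγ0 : 0 ≤ γ)
    (hγ1 : γ < 1) (e a : ℕ → ι → ℝ) (he : ∀ t i, 0 ≤ e t i)
    (ha : ∀ t i, 0 ≤ a t i ∧ a t i ≤ 1)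
    (hsum : ∀ i, Tendsto (fun n => ∑ t ∈ Finset.range n, a t i) atTop atTop)
    (hstep : ∀ t D, (∀ i, e t i ≤ D) → ∀ i, e (t + 1) i ≤ (1 - a t i) * e t i + a t i * (γ * D))
    (i : ι) : Tendsto (fun t => e t i) atTop (𝓝 0) := by
  obtain ⟨D, hD⟩ : ∃ D, ∀ i, e 0 i ≤ D := by
    obtain ⟨D, hD⟩ := (Set.finite_range (e 0)).bddAbove
    exact ⟨D, fun i => hD ⟨i, rfl⟩⟩
  have hD0 : 0 ≤ D := (he 0 i).trans (hD i)
  have hstay : ∀ D, 0 ≤ D → ∀ t₀, (∀ i, e t₀ i ≤ D) → ∀ t ≥ t₀, ∀ i, e t i ≤ D := by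
    intro D hD0 t₀ h t ht
    induction t, ht using Nat.le_induction with
    | base => exact h
    | succ t _ ih =>
      intro i
      have h1 := hstep t D ih i
      have h2 := mul_le_mul_of_nonneg_left (ih i) (sub_nonneg.2 (ha t i).2)
      have h3 : a t i * (γ * D) ≤ a t i * D :=
        mul_le_mul_of_nonneg_left (mul_le_of_le_one_left hD0 hγ1.le) (ha t i).1
      linarith
  -- The errors are driven towards γD but may never reach it; the midpoint factor (1+γ)/2 is reached
  -- in finite time and is still below 1.
  have hshrink : ∀ D, 0 ≤ D → ∀ t₀, (∀ t ≥ t₀, ∀ i, e t i ≤ D) →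
      ∃ t₁, ∀ t ≥ t₁, ∀ i, e t i ≤ (1 + γ) / 2 * D := by
    intro D hD0 t₀ h
    rcases hD0.eq_or_lt with rfl | hDpos
    · exact ⟨t₀, fun t ht i => by simpa using h t ht i⟩
    -- The excess over γD is multiplied by at most 1 - a ≤ exp(-a) at each step.
    have key : ∀ i, ∀ t ≥ t₀, e t i ≤ γ * D + (D - γ * D) *
        Real.exp (-(∑ s ∈ Finset.range t, a s i - ∑ s ∈ Finset.range t₀, a s i)) := by
      intro i t ht
      induction t, ht using Nat.le_induction with
      | base => simpa using h t₀ le_rfl i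
      | succ t ht ih =>
        have h1 := hstep t D (h t ht) i
        set X := Real.exp (-(∑ s ∈ Finset.range t, a s i - ∑ s ∈ Finset.range t₀, a s i))
        have hX : Real.exp (-(∑ s ∈ Finset.range (t + 1), a s i -
            ∑ s ∈ Finset.range t₀, a s i)) = X * Real.exp (-a t i) := by
          rw [← Real.exp_add, Finset.sum_range_succ]
          ring_nf
        rw [hX]
        have h2 := mul_le_mul_of_nonneg_left ih (sub_nonneg.2 (ha t i).2)
        have h3 : 1 - a t i ≤ Real.exp (-a t i) := by
          have := Real.add_one_le_exp (-a t i)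
          linarith
        have h4 : 0 ≤ (D - γ * D) * X :=
          mul_nonneg (sub_nonneg.2 (mul_le_of_le_one_left hD0 hγ1.le)) (Real.exp_pos _).le
        have h5 := mul_le_mul_of_nonneg_left h3 h4
        nlinarith
    have hev : ∀ᶠ t in atTop, ∀ i, e t i ≤ (1 + γ) / 2 * D := by
      rw [eventually_all]
      intro i
      have hlim : Tendsto (fun t => γ * D + (D - γ * D) *
          Real.exp (-(∑ s ∈ Finset.range t, a s i - ∑ s ∈ Finset.range t₀, a s i))) atTop
          (𝓝 (γ * D + (D - γ * D) * 0)) := by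
        refine tendsto_const_nhds.add (tendsto_const_nhds.mul ?_)
        refine Real.tendsto_exp_atBot.comp (tendsto_neg_atTop_atBot.comp ?_)
        exact tendsto_atTop_add_const_right _ _ (hsum i)
      have hlt : γ * D + (D - γ * D) * 0 < (1 + γ) / 2 * D := by nlinarith
      filter_upwards [hlim.eventually_lt_const hlt, eventually_ge_atTop t₀] with t h1 h2
      exact (key i t h2).trans h1.le
    exact eventually_atTop.1 hev
  have hρ0 : 0 ≤ (1 + γ) / 2 := by linarith
  have hpow : ∀ n : ℕ, ∃ t₀, ∀ t ≥ t₀, ∀ i, e t i ≤ ((1 + γ) / 2) ^ n * D := by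
    intro n
    induction n with
    | zero => exact ⟨0, by simpa using hstay D hD0 0 hD⟩
    | succ n ih =>
      obtain ⟨t₀, h⟩ := ih
      obtain ⟨t₁, h'⟩ := hshrink _ (mul_nonneg (pow_nonneg hρ0 n) hD0) t₀ h
      exact ⟨t₁, fun t ht i => (h' t ht i).trans_eq (by ring)⟩
  have hlim : Tendsto (fun n : ℕ => ((1 + γ) / 2) ^ n * D) atTop (𝓝 0) := by
    simpa using (tendsto_pow_atTop_nhds_zero_of_lt_one hρ0 (by linarith)).mul_const D
  refine tendsto_order.2 ⟨fun b hb => .of_forall fun t => hb.trans_le (he t i), fun b hb => ?_⟩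
  obtain ⟨n, hn⟩ := (hlim.eventually_lt_const hb).exists
  obtain ⟨t₀, h⟩ := hpow n
  filter_upwards [eventually_ge_atTop t₀] with t ht
  exact (h t ht i).trans_lt hn

/-! ### Suprema and finite averages -/

theorem abs_ciSup_sub_ciSup_le {ι : Type*} [Finite ι] [Nonempty ι] {f g : ι → ℝ} {D : ℝ}
    (h : ∀ i, |f i - g i| ≤ D) : |(⨆ i, f i) - ⨆ i, g i| ≤ D := by
  rw [abs_sub_le_iff]
  constructor
  · rw [sub_le_iff_le_add]
    refine ciSup_le fun i => ?_
    have := le_ciSup (Set.finite_range g).bddAbove i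
    linarith [(abs_sub_le_iff.1 (h i)).1]
  · rw [sub_le_iff_le_add]
    refine ciSup_le fun i => ?_
    have := le_ciSup (Set.finite_range f).bddAbove i
    linarith [(abs_sub_le_iff.1 (h i)).2]

theorem abs_sSup_image_sub_sSup_image_le {ι : Type*} {J : Set ι} (hJ : J.Finite)
    (hne : J.Nonempty) {f g : ι → ℝ} {D : ℝ} (h : ∀ i ∈ J, |f i - g i| ≤ D) :
    |sSup (f '' J) - sSup (g '' J)| ≤ D := by
  have := hJ.to_subtype
  have := hne.to_subtype
  rw [sSup_image', sSup_image']
  exact abs_ciSup_sub_ciSup_le fun i : J => h i i.2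

theorem PMF.sum_toReal_eq_one {A : Type*} [Fintype A] (p : PMF A) : ∑ a, (p a).toReal = 1 := by
  rw [← ENNReal.toReal_sum fun a _ => p.apply_ne_top a, ← tsum_fintype (L := .unconditional A),
    p.tsum_coe, ENNReal.toReal_one]

theorem PMF.sum_pure_toReal_mul {S : Type*} [Fintype S] (b : S) (f : S → ℝ) :
    ∑ s, (PMF.pure b s).toReal * f s = f b := by
  classical
  rw [Finset.sum_eq_single b]
  · simp
  · intro s _ hs
    simp [PMF.pure_apply, hs]
  · simp

/-- A convex combination is at most any upper bound of the averaged function. -/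
theorem PMF.sum_toReal_mul_le {A : Type*} [Fintype A] (p : PMF A) {f : A → ℝ} {c : ℝ}
    (h : ∀ a, f a ≤ c) : ∑ a, (p a).toReal * f a ≤ c := by
  calc ∑ a, (p a).toReal * f a ≤ ∑ a, (p a).toReal * c :=
        Finset.sum_le_sum fun a _ => mul_le_mul_of_nonneg_left (h a) ENNReal.toReal_nonneg
    _ = c := by rw [← Finset.sum_mul, p.sum_toReal_eq_one, one_mul]

/-! ### The Bellman equation -/

namespace MDP

variable {S A : Type*}

open Classical in
/-- The value of a state under the table `Q`, zero at terminal states. -/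
noncomputable def stateValue (M : MDP S A) (Q : S → A → ℝ) (s : S) : ℝ :=
  if s ∈ M.terminal then 0 else ⨆ a, Q s a

theorem stateValue_of_mem {M : MDP S A} {s : S} (h : s ∈ M.terminal) (Q : S → A → ℝ) :
    M.stateValue Q s = 0 := if_pos h

theorem stateValue_of_notMem {M : MDP S A} {s : S} (h : s ∉ M.terminal) (Q : S → A → ℝ) :
    M.stateValue Q s = ⨆ a, Q s a := if_neg h

theorem le_stateValue [Finite A] {M : MDP S A} {s : S} (h : s ∉ M.terminal) (Q : S → A → ℝ)
    (a : A) : Q s a ≤ M.stateValue Q s := by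
  rw [stateValue_of_notMem h]
  exact le_ciSup (Set.finite_range (Q s)).bddAbove a

/-- The Bellman optimality equation for transitions given by `g`. -/
def IsBellman [Fintype S] (M : MDP S A) (g : S → A → S) (γ : ℝ) (Q : S → A → ℝ) : Prop :=
  ∀ s a, Q s a = M.reward s a + γ * M.stateValue Q (g s a)

theorem abs_stateValue_sub_le [Finite A] [Nonempty A] (M : MDP S A) {Q Q' : S → A → ℝ} {D : ℝ}
    (hD : 0 ≤ D) (s : S) (h : ∀ a, |Q s a - Q' s a| ≤ D) :
    |M.stateValue Q s - M.stateValue Q' s| ≤ D := by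
  by_cases hs : s ∈ M.terminal
  · simpa [stateValue_of_mem hs] using hD
  · rw [stateValue_of_notMem hs, stateValue_of_notMem hs]
    exact abs_ciSup_sub_ciSup_le h

theorem exists_isBellman [Fintype S] [Fintype A] [Nonempty A] (M : MDP S A) (g : S → A → S)
    {γ : ℝ} (hγ0 : 0 ≤ γ) (hγ1 : γ < 1) : ∃ Q, M.IsBellman g γ Q := by
  let B : (S → A → ℝ) → S → A → ℝ := fun Q s a => M.reward s a + γ * M.stateValue Q (g s a)
  have hB : ContractingWith ⟨γ, hγ0⟩ B := by
    refine ⟨by exact_mod_cast hγ1, LipschitzWith.of_dist_le_mul fun Q Q' => ?_⟩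
    have h0 : 0 ≤ γ * dist Q Q' := mul_nonneg hγ0 dist_nonneg
    refine (dist_pi_le_iff h0).2 fun s => (dist_pi_le_iff h0).2 fun a => ?_
    have h1 := M.abs_stateValue_sub_le (Q := Q) (Q' := Q') dist_nonneg (g s a) fun b =>
      (dist_le_pi_dist (Q (g s a)) (Q' (g s a)) b).trans (dist_le_pi_dist Q Q' (g s a))
    rw [Real.dist_eq]
    simp only [B]
    rw [add_sub_add_left_eq_sub, ← mul_sub, abs_mul, abs_of_nonneg hγ0]
    exact mul_le_mul_of_nonneg_left h1 hγ0
  refine ⟨ContractingWith.fixedPoint B hB, fun s a => ?_⟩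
  exact (congrFun (congrFun hB.fixedPoint_isFixedPt s) a).symm

theorem reward_eq [Fintype S] {M : MDP S A} {g : S → A → S}
    (hg : ∀ s a, M.P s a = PMF.pure (g s a)) (s : S) (a : A) :
    M.reward s a = M.r s a (g s a) := by
  rw [reward, hg, PMF.sum_pure_toReal_mul]

/-! ### The optimal Q-function solves the Bellman equation -/

section Return

variable [Fintype S] [Fintype A] {M : MDP S A} {g : S → A → S}

/-- The discounted return of the first `N` steps. -/
noncomputable def partialReturn (M : MDP S A) (γ : ℝ) (π : S → PMF A) (N : ℕ) (s : S) (a : A) :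
    ℝ :=
  ∑ n ∈ Finset.range N, γ ^ n * M.expReward π n s a

open Classical in
theorem expReward_succ (hg : ∀ s a, M.P s a = PMF.pure (g s a)) (π : S → PMF A) (n : ℕ) (s : S)
    (a : A) : M.expReward π (n + 1) s a =
      if g s a ∈ M.terminal then 0
      else ∑ a', (π (g s a) a').toReal * M.expReward π n (g s a) a' := by
  rw [expReward, hg]
  exact PMF.sum_pure_toReal_mul (g s a) fun s' =>
    if s' ∈ M.terminal then 0 else ∑ a', (π s' a').toReal * M.expReward π n s' a'

open Classical in
theorem partialReturn_succ (hg : ∀ s a, M.P s a = PMF.pure (g s a)) (γ : ℝ) (π : S → PMF A)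
    (N : ℕ) (s : S) (a : A) : M.partialReturn γ π (N + 1) s a = M.reward s a + γ *
      if g s a ∈ M.terminal then 0
      else ∑ a', (π (g s a) a').toReal * M.partialReturn γ π N (g s a) a' := by
  rw [partialReturn, Finset.sum_range_succ']
  simp only [expReward_succ hg]
  rw [pow_zero, one_mul, add_comm, expReward]
  congr 1
  split_ifs with h
  · simp
  · simp only [partialReturn, Finset.mul_sum]
    rw [Finset.sum_comm]
    exact Finset.sum_congr rfl fun a' _ => Finset.sum_congr rfl fun n _ => by ring

theorem abs_expReward_le (hg : ∀ s a, M.P s a = PMF.pure (g s a)) {R : ℝ} (hR0 : 0 ≤ R)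
    (hR : ∀ s a, |M.reward s a| ≤ R) (π : S → PMF A) (n : ℕ) :
    ∀ s a, |M.expReward π n s a| ≤ R := by
  induction n with
  | zero => exact hR
  | succ n ih =>
    intro s a
    rw [expReward_succ hg]
    split_ifs
    · simpa using hR0
    · refine (Finset.abs_sum_le_sum_abs _ _).trans ?_
      simp only [abs_mul, abs_of_nonneg ENNReal.toReal_nonneg]
      exact PMF.sum_toReal_mul_le _ (ih _)

theorem tendsto_partialReturn (hg : ∀ s a, M.P s a = PMF.pure (g s a)) {γ : ℝ} (hγ0 : 0 ≤ γ)
    (hγ1 : γ < 1) (π : S → PMF A) (s : S) (a : A) :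
    Tendsto (fun N => M.partialReturn γ π N s a) atTop (𝓝 (M.actionValue γ π s a)) := by
  obtain ⟨R, hR⟩ : ∃ R, ∀ s a, |M.reward s a| ≤ R := by
    obtain ⟨R, hR⟩ := (Set.finite_range fun y : S × A => |M.reward y.1 y.2|).bddAbove
    exact ⟨R, fun s a => hR ⟨(s, a), rfl⟩⟩
  have hR0 : 0 ≤ R := (abs_nonneg _).trans (hR s a)
  refine HasSum.tendsto_sum_nat (Summable.hasSum ?_)
  refine Summable.of_norm_bounded ((summable_geometric_of_lt_one hγ0 hγ1).mul_right R) fun n => ?_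
  rw [Real.norm_eq_abs, abs_mul, abs_of_nonneg (pow_nonneg hγ0 n)]
  exact mul_le_mul_of_nonneg_left (abs_expReward_le hg hR0 hR π n s a) (pow_nonneg hγ0 n)

/-- Truncated returns obey the Bellman recursion with an average in place of the maximum; stopping
after N steps costs at most γ^N C, which vanishes. -/
theorem IsBellman.actionValue_le (hg : ∀ s a, M.P s a = PMF.pure (g s a)) {γ : ℝ} (hγ0 : 0 ≤ γ)
    (hγ1 : γ < 1) {Q : S → A → ℝ} (hQ : M.IsBellman g γ Q) (π : S → PMF A) (s : S) (a : A) :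
    M.actionValue γ π s a ≤ Q s a := by
  obtain ⟨C, hC⟩ : ∃ C, ∀ s a, |Q s a| ≤ C := by
    obtain ⟨C, hC⟩ := (Set.finite_range fun y : S × A => |Q y.1 y.2|).bddAbove
    exact ⟨C, fun s a => hC ⟨(s, a), rfl⟩⟩
  have hC0 : 0 ≤ C := (abs_nonneg _).trans (hC s a)
  have key : ∀ N s a, M.partialReturn γ π N s a ≤ Q s a + γ ^ N * C := by
    intro N
    induction N with
    | zero =>
      intro s a
      have := neg_le_of_abs_le (hC s a)
      simp only [partialReturn, Finset.range_zero, Finset.sum_empty, pow_zero, one_mul]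
      linarith
    | succ N ih =>
      intro s a
      rw [partialReturn_succ hg, hQ s a, add_assoc, pow_succ', mul_assoc, ← mul_add]
      refine add_le_add le_rfl (mul_le_mul_of_nonneg_left ?_ hγ0)
      split_ifs with h
      · rw [stateValue_of_mem h, zero_add]
        positivity
      · exact PMF.sum_toReal_mul_le _ fun b =>
          (ih _ b).trans (add_le_add (le_stateValue h Q b) le_rfl)
  have hlim : Tendsto (fun N : ℕ => Q s a + γ ^ N * C) atTop (𝓝 (Q s a)) := by
    simpa using ((tendsto_pow_atTop_nhds_zero_of_lt_one hγ0 hγ1).mul_const C).const_add (Q s a)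
  exact le_of_tendsto_of_tendsto' (tendsto_partialReturn hg hγ0 hγ1 π s a) hlim
    fun N => key N s a

/-- A greedy policy attains the solution of the Bellman equation. -/
theorem IsBellman.exists_actionValue_eq [Nonempty A] (hg : ∀ s a, M.P s a = PMF.pure (g s a))
    {γ : ℝ} (hγ0 : 0 ≤ γ) (hγ1 : γ < 1) {Q : S → A → ℝ} (hQ : M.IsBellman g γ Q) :
    ∃ π, ∀ s a, M.actionValue γ π s a = Q s a := by
  choose b hb using fun s => exists_eq_ciSup_of_finite (f := Q s)
  refine ⟨fun s => PMF.pure (b s), fun s a => ?_⟩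
  obtain ⟨C, hC⟩ : ∃ C, ∀ s a, |Q s a| ≤ C := by
    obtain ⟨C, hC⟩ := (Set.finite_range fun y : S × A => |Q y.1 y.2|).bddAbove
    exact ⟨C, fun s a => hC ⟨(s, a), rfl⟩⟩
  have hC0 : 0 ≤ C := (abs_nonneg _).trans (hC s a)
  have key : ∀ N s a,
      |M.partialReturn γ (fun s => PMF.pure (b s)) N s a - Q s a| ≤ γ ^ N * C := by
    intro N
    induction N with
    | zero =>
      intro s a
      simpa [partialReturn] using hC s a
    | succ N ih =>
      intro s a
      rw [partialReturn_succ hg, hQ s a, add_sub_add_left_eq_sub, ← mul_sub, pow_succ', mul_assoc,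
        abs_mul, abs_of_nonneg hγ0]
      refine mul_le_mul_of_nonneg_left ?_ hγ0
      split_ifs with h
      · rw [stateValue_of_mem h, sub_zero, abs_zero]
        positivity
      · rw [stateValue_of_notMem h, PMF.sum_pure_toReal_mul, ← hb]
        exact ih _ _
  refine tendsto_nhds_unique (tendsto_partialReturn hg hγ0 hγ1 _ s a) ?_
  rw [tendsto_iff_dist_tendsto_zero]
  refine squeeze_zero (fun _ => dist_nonneg) (fun N => key N s a) ?_
  simpa using (tendsto_pow_atTop_nhds_zero_of_lt_one hγ0 hγ1).mul_const C

/-- A Bellman solution dominates every policy and is attained by a greedy one, so it is the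
supremum. -/
theorem isBellman_optimalQ [Nonempty A] (hg : ∀ s a, M.P s a = PMF.pure (g s a)) {γ : ℝ}
    (hγ0 : 0 ≤ γ) (hγ1 : γ < 1) : M.IsBellman g γ (M.optimalQ γ) := by
  obtain ⟨Q, hQ⟩ := M.exists_isBellman g hγ0 hγ1
  obtain ⟨π, hπ⟩ := hQ.exists_actionValue_eq hg hγ0 hγ1
  have : M.optimalQ γ = Q := by
    funext s a
    have : Nonempty (S → PMF A) := ⟨π⟩
    refine le_antisymm (ciSup_le fun π' => hQ.actionValue_le hg hγ0 hγ1 π' s a) ?_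
    rw [← hπ s a]
    exact le_ciSup (f := fun π' => M.actionValue γ π' s a)
      ⟨Q s a, by rintro _ ⟨π', rfl⟩; exact hQ.actionValue_le hg hγ0 hγ1 π' s a⟩ π
  rwa [this]

end Return

/-! ### Backward returns along an episode -/

namespace Path

variable {M : MDP S A}

theorem one_le_length {s : S} {a : A} (p : M.Path s a) : 1 ≤ p.length := by
  cases p <;> simp [length]

@[simp] theorem st_zero {s : S} {a : A} (p : M.Path s a) : p.st 0 = s := by
  cases p <;> rfl

@[simp] theorem act_zero {s : S} {a : A} (p : M.Path s a) : p.act 0 = a := by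
  cases p <;> rfl

theorem st_length_mem {s : S} {a : A} (p : M.Path s a) : p.st p.length ∈ M.terminal := by
  induction p with
  | last s a s' hP hs' => exact hs'
  | cons s a s' a' hP hs' p ih => exact ih

theorem st_notMem {s : S} {a : A} (p : M.Path s a) {k : ℕ} (h1 : 1 ≤ k) (hk : k < p.length) :
    p.st k ∉ M.terminal := by
  induction p generalizing k with
  | last s a s' hP hs' => simp only [length] at hk; omega
  | cons s a s' a' hP hs' p ih =>
    obtain ⟨k, rfl⟩ := Nat.exists_eq_add_of_le' h1
    simp only [length] at hk
    rcases Nat.eq_zero_or_pos k with rfl | h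
    · simpa [st] using hs'
    · exact ih h (by omega)

theorem P_pos {s : S} {a : A} (p : M.Path s a) {k : ℕ} (hk : k < p.length) :
    0 < M.P (p.st k) (p.act k) (p.st (k + 1)) := by
  induction p generalizing k with
  | last s a s' hP hs' =>
    simp only [length] at hk
    obtain rfl : k = 0 := by omega
    exact hP
  | cons s a s' a' hP hs' p ih =>
    simp only [length] at hk
    rcases k with _ | k
    · simpa [st, act] using hP
    · exact ih (by omega)

theorem st_succ {g : S → A → S} (hg : ∀ s a, M.P s a = PMF.pure (g s a)) {s : S} {a : A}
    (p : M.Path s a) {k : ℕ} (hk : k < p.length) : p.st (k + 1) = g (p.st k) (p.act k) := by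
  classical
  have h := p.P_pos hk
  rw [hg, PMF.pure_apply] at h
  by_contra hne
  simp [hne] at h

/-- The indices admitted in the backward return. -/
def admissible {s : S} {a : A} (p : M.Path s a) : Set ℕ :=
  {j | 1 ≤ j ∧ j ≤ p.length ∧ (j = p.length ∨ ∃ b : A, b ≠ p.act j)}

theorem admissible_finite {s : S} {a : A} (p : M.Path s a) : p.admissible.Finite :=
  (Set.finite_Icc 1 p.length).subset fun _ hj => ⟨hj.1, hj.2.1⟩

theorem length_mem_admissible {s : S} {a : A} (p : M.Path s a) : p.length ∈ p.admissible :=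
  ⟨p.one_le_length, le_rfl, .inl rfl⟩

/-- The backward return is nonexpansive in the table, restricted to the non-terminal states. -/
theorem abs_maxT_sub_le [Finite A] {s : S} {a : A} (p : M.Path s a) {β γ : ℝ} (hβ0 : 0 ≤ β)
    (hβ1 : β ≤ 1) (hγ0 : 0 ≤ γ) (hγ1 : γ ≤ 1) {Q Q' : S → A → ℝ} {D : ℝ} (hD : 0 ≤ D)
    (h : ∀ s ∉ M.terminal, ∀ a, |Q s a - Q' s a| ≤ D) :
    |p.maxT β γ Q - p.maxT β γ Q'| ≤ D := by
  refine abs_sSup_image_sub_sSup_image_le p.admissible_finite ⟨_, p.length_mem_admissible⟩ ?_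
  rintro j ⟨h1, hj, hj'⟩
  -- Since 1 - β ≤ 1 - βγ, the weights (1-β)(βγ)^(k-1) sum to at most 1 - (βγ)^(j-1), which leaves
  -- room for the weight of the final maximum.
  have hsum : |(∑ k ∈ Finset.Ico 1 j, β ^ (k - 1) * γ ^ (k - 1) *
        (β * M.r (p.st k) (p.act k) (p.st (k + 1)) + (1 - β) * Q (p.st k) (p.act k))) -
      ∑ k ∈ Finset.Ico 1 j, β ^ (k - 1) * γ ^ (k - 1) *
        (β * M.r (p.st k) (p.act k) (p.st (k + 1)) + (1 - β) * Q' (p.st k) (p.act k))| ≤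
      D * (1 - β ^ (j - 1) * γ ^ (j - 1)) := by
    -- Admissibility of j does not pass to smaller indices and would block the induction.
    clear hj'
    induction j, h1 using Nat.le_induction with
    | base => simp
    | succ j h1 ih =>
      have ih := ih (by omega)
      have hq := h _ (p.st_notMem h1 (by omega)) (p.act j)
      obtain ⟨i, rfl⟩ := Nat.exists_eq_add_of_le' h1
      rw [Finset.sum_Ico_succ_top h1, Finset.sum_Ico_succ_top h1]
      simp only [Nat.add_sub_cancel] at ih ⊢
      set c := β ^ i * γ ^ i with hc
      have hc0 : 0 ≤ c := by positivity
      rw [abs_le] at ih hq ⊢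
      have hw : 0 ≤ c * (1 - β) := mul_nonneg hc0 (by linarith)
      have e1 := mul_le_mul_of_nonneg_left hq.1 hw
      have e2 := mul_le_mul_of_nonneg_left hq.2 hw
      have e3 : 0 ≤ D * (c * (β * (1 - γ))) :=
        mul_nonneg hD (mul_nonneg hc0 (mul_nonneg hβ0 (by linarith)))
      have e4 : β ^ (i + 1) * γ ^ (i + 1) = c * (β * γ) := by rw [hc]; ring
      rw [e4]
      constructor <;> nlinarith
  have htail : |(if j = p.length then 0 else ⨆ b : {b : A // b ≠ p.act j}, Q (p.st j) b) -
      (if j = p.length then 0 else ⨆ b : {b : A // b ≠ p.act j}, Q' (p.st j) b)| ≤ D := by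
    split_ifs with hl
    · simpa using hD
    · obtain ⟨b, hb⟩ := hj'.resolve_left hl
      have : Nonempty {b : A // b ≠ p.act j} := ⟨⟨b, hb⟩⟩
      exact abs_ciSup_sub_ciSup_le fun b => h _ (p.st_notMem h1 (by omega)) b
  have hc0 : 0 ≤ β ^ (j - 1) * γ ^ (j - 1) := by positivity
  unfold T
  rw [abs_le] at hsum htail ⊢
  have e1 := mul_le_mul_of_nonneg_left htail.1 hc0
  have e2 := mul_le_mul_of_nonneg_left htail.2 hc0
  constructor <;> nlinarith

/-- This form makes the sum in `T` telescope when the actions are greedy. -/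
theorem mul_reward_add_eq [Fintype S] {g : S → A → S} {s : S} {a : A} {γ : ℝ} {Q : S → A → ℝ}
    (hg : ∀ s a, M.P s a = PMF.pure (g s a))
    (hQ : M.IsBellman g γ Q) (p : M.Path s a) (β : ℝ) {k : ℕ} (hk : k < p.length) :
    β * M.r (p.st k) (p.act k) (p.st (k + 1)) + (1 - β) * Q (p.st k) (p.act k) =
      Q (p.st k) (p.act k) - β * γ * M.stateValue Q (p.st (k + 1)) := by
  have h := hQ (p.st k) (p.act k)
  rw [reward_eq hg, ← p.st_succ hg hk] at h
  linear_combination -β * h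

/-- For the solution of the Bellman equation, the backward return of any episode is the value of
the successor state. -/
theorem maxT_eq_stateValue [Fintype S] [Fintype A] {g : S → A → S}
    (hg : ∀ s a, M.P s a = PMF.pure (g s a)) {s : S} {a : A} {β γ : ℝ} (hβ0 : 0 ≤ β)
    (hγ0 : 0 ≤ γ) {Q : S → A → ℝ} (hQ : M.IsBellman g γ Q) (p : M.Path s a) :
    p.maxT β γ Q = M.stateValue Q (g s a) := by
  have hst1 : p.st 1 = g s a := by simpa using p.st_succ hg p.one_le_length
  set U : ℕ → ℝ := fun j =>
    if j = p.length then 0 else ⨆ b : {b : A // b ≠ p.act j}, Q (p.st j) b with hU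
  have hUle : ∀ j ∈ p.admissible, U j ≤ M.stateValue Q (p.st j) := by
    rintro j ⟨h1, hj, hj'⟩
    simp only [hU]
    split_ifs with hl
    · rw [hl, stateValue_of_mem p.st_length_mem]
    · obtain ⟨b, hb⟩ := hj'.resolve_left hl
      have : Nonempty {b : A // b ≠ p.act j} := ⟨⟨b, hb⟩⟩
      exact ciSup_le fun b => le_stateValue (p.st_notMem h1 (by omega)) Q b
  have hupper : ∀ j, 1 ≤ j → j ≤ p.length →
      ∑ k ∈ Finset.Ico 1 j, β ^ (k - 1) * γ ^ (k - 1) *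
        (β * M.r (p.st k) (p.act k) (p.st (k + 1)) + (1 - β) * Q (p.st k) (p.act k)) ≤
      M.stateValue Q (p.st 1) - β ^ (j - 1) * γ ^ (j - 1) * M.stateValue Q (p.st j) := by
    intro j h1
    induction j, h1 using Nat.le_induction with
    | base => intro; simp
    | succ j h1 ih =>
      intro hj
      have ih := ih (by omega)
      have hq := le_stateValue (p.st_notMem h1 (by omega)) Q (p.act j)
      rw [Finset.sum_Ico_succ_top h1, mul_reward_add_eq hg hQ p β (by omega)]
      obtain ⟨i, rfl⟩ := Nat.exists_eq_add_of_le' h1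
      simp only [Nat.add_sub_cancel] at ih ⊢
      have := mul_le_mul_of_nonneg_left hq (show 0 ≤ β ^ i * γ ^ i by positivity)
      rw [pow_succ, pow_succ]
      nlinarith
  have hequal : ∀ j, 1 ≤ j → j ≤ p.length →
      (∀ k, 1 ≤ k → k < j → Q (p.st k) (p.act k) = M.stateValue Q (p.st k)) →
      ∑ k ∈ Finset.Ico 1 j, β ^ (k - 1) * γ ^ (k - 1) *
        (β * M.r (p.st k) (p.act k) (p.st (k + 1)) + (1 - β) * Q (p.st k) (p.act k)) =
      M.stateValue Q (p.st 1) - β ^ (j - 1) * γ ^ (j - 1) * M.stateValue Q (p.st j) := by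
    intro j h1
    induction j, h1 using Nat.le_induction with
    | base => intros; simp
    | succ j h1 ih =>
      intro hj hopt
      have ih := ih (by omega) fun k hk hkj => hopt k hk (by omega)
      have hq := hopt j h1 (by omega)
      rw [Finset.sum_Ico_succ_top h1, mul_reward_add_eq hg hQ p β (by omega), ih, hq]
      obtain ⟨i, rfl⟩ := Nat.exists_eq_add_of_le' h1
      simp only [Nat.add_sub_cancel]
      ring
  have hT : ∀ j ∈ p.admissible, p.T β γ Q j ≤ M.stateValue Q (p.st 1) := by
    intro j hj
    have h1 := hupper j hj.1 hj.2.1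
    have h2 := mul_le_mul_of_nonneg_left (hUle j hj)
      (show 0 ≤ β ^ (j - 1) * γ ^ (j - 1) by positivity)
    simp only [hU] at h2
    unfold T
    linarith
  rw [← hst1]
  refine le_antisymm (csSup_le (Set.Nonempty.image _ ⟨_, p.length_mem_admissible⟩) ?_) ?_
  · rintro _ ⟨j, hj, rfl⟩
    exact hT j hj
  -- The maximum is attained where the episode first leaves the greedy actions.
  classical
  have hex : ∃ j, j ∈ p.admissible ∧ U j = M.stateValue Q (p.st j) :=
    ⟨p.length, p.length_mem_admissible, by
      rw [stateValue_of_mem p.st_length_mem]; simp [hU]⟩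
  obtain ⟨hj, hUj⟩ := Nat.find_spec hex
  have hmin := fun k (hk : k < Nat.find hex) => Nat.find_min hex hk
  generalize Nat.find hex = j at hj hUj hmin
  have hopt : ∀ k, 1 ≤ k → k < j → Q (p.st k) (p.act k) = M.stateValue Q (p.st k) := by
    intro k h1 hkj
    have hkl : k < p.length := hkj.trans_le hj.2.1
    have hnt := p.st_notMem h1 hkl
    have : Nonempty A := ⟨a⟩
    obtain ⟨b, hb⟩ := exists_eq_ciSup_of_finite (f := Q (p.st k))
    rw [← stateValue_of_notMem hnt] at hb
    -- An optimal action other than a_k would make k an earlier witness, against minimality of j.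
    by_cases hbk : b = p.act k
    · rw [← hbk, hb]
    · exfalso
      have hadm : k ∈ p.admissible := ⟨h1, hkl.le, .inr ⟨b, hbk⟩⟩
      refine hmin k hkj ⟨hadm, le_antisymm (hUle k hadm) ?_⟩
      simp only [hU, if_neg hkl.ne]
      rw [← hb]
      exact le_ciSup (f := fun b : {b : A // b ≠ p.act k} => Q (p.st k) b)
        (Set.finite_range _).bddAbove ⟨b, hbk⟩
  have hTj : p.T β γ Q j = M.stateValue Q (p.st 1) := by
    have h1 := hequal j hj.1 hj.2.1 hopt
    simp only [hU] at hUj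
    unfold T
    rw [h1, hUj]
    ring
  rw [← hTj]
  exact le_csSup (p.admissible_finite.image _).bddAbove ⟨j, hj, rfl⟩

end Path

/-! ### Averaging over schedules and convergence -/

/-- Averaging values within `D` of `v` against a schedule stays within `D` of `v`. -/
theorem IsSchedule.abs_tsum_mul_sub_le {M : MDP S A} {s : S} {a : A} {w : M.Path s a → ℝ}
    (hw : IsSchedule w) {f : M.Path s a → ℝ} {v D : ℝ} (h : ∀ p, |f p - v| ≤ D) :
    |∑' p, w p * f p - v| ≤ D := by
  have hD := hw.2.mul_right D
  have hbd : ∀ p, ‖w p * (f p - v)‖ ≤ w p * D := fun p => by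
    rw [Real.norm_eq_abs, abs_mul, abs_of_nonneg (hw.1 p)]
    exact mul_le_mul_of_nonneg_left (h p) (hw.1 p)
  -- Splitting f as (f - v) + v proves summability of w f, without which the `tsum` would default to
  -- 0.
  have hsum := (Summable.of_norm_bounded hD.summable hbd).hasSum.add (hw.2.mul_right v)
  have heq : (fun p => w p * (f p - v) + w p * v) = fun p => w p * f p := by
    funext p
    ring
  rw [heq] at hsum
  rw [hsum.tsum_eq, one_mul, add_sub_cancel_right]
  simpa using tsum_of_norm_bounded hD hbd

/-- Pathwise convergence of the episodic backward update. -/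
theorem tendsto_ebu [Fintype S] [Fintype A] (M : MDP S A) (hdet : M.IsDeterministic) {β γ : ℝ}
    (hβ0 : 0 ≤ β) (hβ1 : β ≤ 1) (hγ0 : 0 ≤ γ) (hγ1 : γ < 1) (Q₀ : S → A → ℝ) (x : ℕ → S × A)
    (α : ℕ → ℝ) (sched : ℕ → (s : S) → (a : A) → M.Path s a → ℝ)
    (hsched : ∀ t, ∀ s ∉ M.terminal, ∀ a, IsSchedule (sched t s a)) (hRM : M.RobbinsMonro x α)
    {s : S} (hs : s ∉ M.terminal) (a : A) :
    Tendsto (fun t => M.ebu β γ Q₀ x α sched t s a) atTop (𝓝 (M.optimalQ γ s a)) := by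
  obtain ⟨g, hg⟩ := hdet
  have : Nonempty A := ⟨a⟩
  have hB := isBellman_optimalQ hg hγ0 hγ1
  rw [tendsto_iff_dist_tendsto_zero]
  -- Only non-terminal pairs are indexed: entries at terminal states are uncontrolled, but no
  -- backward return reads them.
  refine tendsto_zero_of_async_contraction (ι := {s // s ∉ M.terminal} × A) hγ0 hγ1
    (fun t i => dist (M.ebu β γ Q₀ x α sched t i.1 i.2) (M.optimalQ γ i.1 i.2))
    (fun t i => stepAt x α i.1 i.2 t) (fun _ _ => dist_nonneg) ?_
    (fun i => (hRM.2 i.1 i.1.2 i.2).1) ?_ (⟨s, hs⟩, a)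
  · intro t i
    unfold stepAt
    split_ifs
    · exact hRM.1 t
    · simp
  rintro t D hD ⟨⟨s, hs⟩, a⟩
  simp only [Real.dist_eq] at hD ⊢
  have hD0 : 0 ≤ D := (abs_nonneg _).trans (hD (⟨s, hs⟩, a))
  set Q := M.ebu β γ Q₀ x α sched t with hQ
  by_cases hx : (s, a) = x t
  · rw [stepAt, if_pos hx, ebu]
    beta_reduce
    rw [if_pos hx, ← hQ]
    have htarget := (hsched t s hs a).abs_tsum_mul_sub_le (f := fun p => p.maxT β γ Q)
      (v := M.stateValue (M.optimalQ γ) (g s a)) (D := D) fun p => by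
        rw [← p.maxT_eq_stateValue hg hβ0 hγ0 hB]
        exact p.abs_maxT_sub_le hβ0 hβ1 hγ0 hγ1.le hD0 fun s hs a => hD (⟨s, hs⟩, a)
    set τ := ∑' p, sched t s a p * p.maxT β γ Q
    have hdiff : (1 - α t) * Q s a + α t * (M.reward s a + γ * τ) - M.optimalQ γ s a =
        (1 - α t) * (Q s a - M.optimalQ γ s a) +
          α t * (γ * (τ - M.stateValue (M.optimalQ γ) (g s a))) := by
      linear_combination -α t * hB s a
    rw [hdiff]
    refine (abs_add_le _ _).trans ?_
    rw [abs_mul, abs_mul, abs_mul, abs_of_nonneg (sub_nonneg.2 (hRM.1 t).2),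
      abs_of_nonneg (hRM.1 t).1, abs_of_nonneg hγ0]
    exact add_le_add le_rfl
      (mul_le_mul_of_nonneg_left (mul_le_mul_of_nonneg_left htarget hγ0) (hRM.1 t).1)
  · rw [stepAt, if_neg hx, ebu]
    beta_reduce
    rw [if_neg hx, ← hQ]
    simp

end MDP

/-- On a finite deterministic MDP, the tabular episodic backward update converges almost surely to
the optimal Q-function. The visited pairs `x t`, the step sizes `α t`, the schedules `sched t` and
the initial table `Q₀` are random. -/
theorem theorem1 {S A Ω : Type*} [Fintype S] [Fintype A]
    [MeasurableSpace Ω] (μ : Measure Ω) [IsProbabilityMeasure μ]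
    (M : MDP S A) (hdet : M.IsDeterministic)
    (β γ : ℝ) (hβ0 : 0 ≤ β) (hβ1 : β ≤ 1) (hγ0 : 0 ≤ γ) (hγ1 : γ < 1)
    (Q₀ : Ω → S → A → ℝ) (x : ℕ → Ω → S × A) (α : ℕ → Ω → ℝ)
    (sched : ℕ → Ω → (s : S) → (a : A) → M.Path s a → ℝ)
    (hsched : ∀ᵐ ω ∂μ, ∀ t, ∀ s ∉ M.terminal, ∀ a, MDP.IsSchedule (sched t ω s a))
    (hRM : ∀ᵐ ω ∂μ, M.RobbinsMonro (fun t => x t ω) (fun t => α t ω))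
    (hlen : ∀ t, ∫⁻ ω, ∑' p : M.Path (x t ω).1 (x t ω).2,
      ENNReal.ofReal (sched t ω (x t ω).1 (x t ω).2 p) * (p.length : ENNReal) ∂μ < ⊤)
    (hvisit : ∀ᵐ ω ∂μ, ∀ s ∉ M.terminal, ∀ a, ∃ᶠ t in atTop, x t ω = (s, a)) :
    ∀ᵐ ω ∂μ, ∀ s ∉ M.terminal, ∀ a,
      Tendsto (fun t => M.ebu β γ (Q₀ ω) (fun t => x t ω) (fun t => α t ω)
        (fun t => sched t ω) t s a) atTop (𝓝 (M.optimalQ γ s a)) := by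
  filter_upwards [hsched, hRM] with ω h1 h2 s hs a
  exact M.tendsto_ebu hdet hβ0 hβ1 hγ0 hγ1 _ _ _ _ h1 h2 hs a
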